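/- Let $E=\{0,\dots,m\}$ and let $F^i:\mathbb R^d\to\mathbb R^d$, $i\in E$, be bounded $C^\infty$ vector fields with flows $\Phi^i(t,x)$. Let $M\subset\mathbb R^d$ be compact with $\Phi^i(t,x)\in M$ for all $i\in E$, $t\ge 0$, $x\in M$. Let $\lambda>0$ and let $x\mapsto Q(x)=(Q(x,i,j))_{i,j\in E}$ be a continuous map on $\mathbb R^d$ whose values are irreducible aperiodic Markov transition matrices (for every $x$ there is $n$ with $Q(x)^n(i,j)>0$ for all $i,j$). *The process.* For $(x,i)\in\mathbb R^d\times E$ let $\mathbb P_{x,i}$ be the law under which $U_1,U_2,\dots$ are i.i.d. exponential with parameter $\lambda$, $\tilde X_0=x$, $\tilde Y_0=i$, $\tilde X_{n+1}=\Phi^{\tilde Y_n}(U_{n+1},\tilde X_n)$, and, conditionally on the past $(U_k,\tilde X_k,\tilde Y_k)_{k\le n}$ and on $U_{n+1}$, $\tilde Y_{n+1}=j$ with probability $Q(\tilde X_{n+1},\tilde Y_n,j)$, where $U_{n+1}$ is independent of that past. With $T_n=U_1+\dots+U_n$ put $X_t=\Phi^{\tilde Y_n}(t-T_n,\tilde X_n)$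 for $t\in[T_n,T_{n+1})$. *The control system.* Let $V$ be either $S=\{v\in\mathbb R^{m+1}: \sum_i v_i=1,\ v_i\in\{0,1\}\}$ or the simplex $\mathrm{co}(S)$, and consider $\dot x(t)=\sum_{i=0}^m v_i(t)F^i(x(t))$ with measurable controls $v:[0,\infty)\to V$ and (absolutely continuous) solutions $\varphi(t,x,v)$, $\varphi(0,x,v)=x$. Let $\mathcal O^+(x)=\{\varphi(t,x,v): t\ge 0,\ v \text{ a control}\}$. A control set is a nonempty set $D\subset\mathbb R^d$ such that (i) for every $x\in D$ there is a control $v$ with $\varphi(t,x,v)\in D$ for all $t\ge0$, (ii) $D\subset\mathrm{cl}\,\mathcal O^+(x)$ for every $x\in D$, and (iii) $D$ is maximal with these properties. A control set $C$ is an invariant control set if $\mathrm{cl}\,C=\mathrm{cl}\,\mathcal O^+(x)$ for all $x\in C$. Its domain of attraction is $\mathcal A(C)=\{x\in\mathbb R^d:\mathrm{cl}\,\mathcal O^+(x)\cap C\neq\emptyset\}$. *Statement.* Let $C\subset M$ be an invariant control set with nonempty interior and let $x\in\mathcal A(C)$. Then there are $T_x>0$ and $\varepsilon_x>0$ such that $$\mathbb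 P_{x,i}\left[X_{T_x}\in\mathrm{int}\,C\right]\ge\varepsilon_x\quad\text{for all } i\in E.$$ -/

import Mathlib

open MeasureTheory ProbabilityTheory Set Filter Topology

noncomputable section

/-! ### The flow of a bounded smooth vector field -/

namespace BoundedFlow

variable {X : Type*} [NormedAddCommGroup X] [NormedSpace ℝ X]

/-- Uniqueness of solutions of `γ' = f (γ)` on a symmetric time interval. -/
theorem unique {f : X → X} (hf : ContDiff ℝ 1 f) {γ δ : ℝ → X} {T : ℝ} (hT : 0 < T)
    (hγ : ∀ t ∈ Icc (-T) T, HasDerivWithinAt γ (f (γ t)) (Icc (-T) T) t)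
    (hδ : ∀ t ∈ Icc (-T) T, HasDerivWithinAt δ (f (δ t)) (Icc (-T) T) t)
    (h0 : γ 0 = δ 0) : EqOn γ δ (Icc (-T) T) := by
  have cγ : ContinuousOn γ (Icc (-T) T) := fun t ht => (hγ t ht).continuousWithinAt
  have cδ : ContinuousOn δ (Icc (-T) T) := fun t ht => (hδ t ht).continuousWithinAt
  obtain ⟨K, hK⟩ := (hf.locallyLipschitz.locallyLipschitzOn
    (s := γ '' Icc (-T) T ∪ δ '' Icc (-T) T)).exists_lipschitzOnWith_of_compact
    ((isCompact_Icc.image_of_continuousOn cγ).union (isCompact_Icc.image_of_continuousOn cδ))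
  refine ODE_solution_unique_of_mem_Icc (v := fun _ => f)
    (s := fun _ => γ '' Icc (-T) T ∪ δ '' Icc (-T) T) (K := K) (t₀ := 0)
    (fun _ _ => hK) ⟨by linarith, hT⟩ cγ ?_ ?_ cδ ?_ ?_ h0
  · exact fun t ht => (hγ t (Ioo_subset_Icc_self ht)).hasDerivAt (Icc_mem_nhds ht.1 ht.2)
  · exact fun t ht => Or.inl (mem_image_of_mem _ (Ioo_subset_Icc_self ht))
  · exact fun t ht => (hδ t (Ioo_subset_Icc_self ht)).hasDerivAt (Icc_mem_nhds ht.1 ht.2)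
  · exact fun t ht => Or.inr (mem_image_of_mem _ (Ioo_subset_Icc_self ht))

/-- A local flow on a prescribed time interval, for a bounded vector field. -/
theorem exists_local [FiniteDimensional ℝ X] {f : X → X} (hf : ContDiff ℝ 1 f)
    (hb : ∃ K, ∀ x, ‖f x‖ ≤ K) (x₀ : X) {T : ℝ} (hT : 0 < T) :
    ∃ α : X × ℝ → X, (∀ x ∈ Metric.closedBall x₀ 1, α (x, 0) = x ∧
      ∀ t ∈ Icc (-T) T,
        HasDerivWithinAt (fun s => α (x, s)) (f (α (x, t))) (Icc (-T) T) t) ∧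
      ContinuousOn α (Metric.closedBall x₀ 1 ×ˢ Icc (-T) T) := by
  have : ProperSpace X := FiniteDimensional.proper ℝ X
  have : CompleteSpace X := FiniteDimensional.complete ℝ X
  obtain ⟨K₀, hK₀⟩ := hb
  have hK₀0 : 0 ≤ K₀ := (norm_nonneg _).trans (hK₀ x₀)
  lift K₀ to NNReal using hK₀0
  lift T to NNReal using hT.le
  obtain ⟨L, hL⟩ := (hf.locallyLipschitz.locallyLipschitzOn
    (s := Metric.closedBall x₀ ((K₀ * T + 1 : NNReal) : ℝ))).exists_lipschitzOnWith_of_compact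
    (isCompact_closedBall _ _)
  have hpl : IsPicardLindelof (fun _ => f) (tmin := -(T : ℝ)) (tmax := T)
      ⟨0, by simp⟩ x₀ (K₀ * T + 1) 1 K₀ L :=
    IsPicardLindelof.of_time_independent (fun x _ => hK₀ x) hL (by simp)
  simpa using hpl.exists_forall_mem_closedBall_eq_hasDerivWithinAt_continuousOn

/-- Global existence for a bounded vector field. -/
theorem exists_global [FiniteDimensional ℝ X] {f : X → X} (hf : ContDiff ℝ 1 f)
    (hb : ∃ K, ∀ x, ‖f x‖ ≤ K) (x : X) :
    ∃ γ : ℝ → X, γ 0 = x ∧ ∀ t, HasDerivAt γ (f (γ t)) t := by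
  have hloc : ∀ n : ℕ, ∃ γ : ℝ → X, γ 0 = x ∧ ∀ t ∈ Icc (-((n : ℝ) + 1)) ((n : ℝ) + 1),
      HasDerivWithinAt γ (f (γ t)) (Icc (-((n : ℝ) + 1)) ((n : ℝ) + 1)) t := by
    intro n
    obtain ⟨α, hα, -⟩ := exists_local hf hb x (T := (n : ℝ) + 1) (by positivity)
    exact ⟨fun s => α (x, s), hα x (Metric.mem_closedBall_self zero_le_one)⟩
  choose γ hγ0 hγ using hloc
  have hagree : ∀ m n : ℕ, m ≤ n →
      EqOn (γ m) (γ n) (Icc (-((m : ℝ) + 1)) ((m : ℝ) + 1)) := by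
    intro m n hmn
    have hmn' : (m : ℝ) ≤ n := by exact_mod_cast hmn
    have hsub : Icc (-((m : ℝ) + 1)) ((m : ℝ) + 1) ⊆ Icc (-((n : ℝ) + 1)) ((n : ℝ) + 1) :=
      Icc_subset_Icc (by linarith) (by linarith)
    exact unique hf (by positivity) (hγ m)
      (fun t ht => (hγ n t (hsub ht)).mono hsub) ((hγ0 m).trans (hγ0 n).symm)
  have key : ∀ (t : ℝ) (n : ℕ), |t| < (n : ℝ) + 1 → γ ⌊|t|⌋₊ t = γ n t := by
    intro t n hn
    have hle : ⌊|t|⌋₊ ≤ n := by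
      have : ⌊|t|⌋₊ < n + 1 := (Nat.floor_lt (abs_nonneg t)).2 (by exact_mod_cast hn)
      omega
    refine hagree _ _ hle ?_
    exact abs_le.1 (Nat.lt_floor_add_one |t|).le
  refine ⟨fun t => γ ⌊|t|⌋₊ t, by simp [hγ0], fun t => ?_⟩
  have ht : |t| < ((⌊|t|⌋₊ : ℕ) : ℝ) + 1 := Nat.lt_floor_add_one _
  have hd : HasDerivAt (γ ⌊|t|⌋₊) (f (γ ⌊|t|⌋₊ t)) t :=
    (hγ _ t (abs_le.1 ht.le)).hasDerivAt (Icc_mem_nhds (abs_lt.1 ht).1 (abs_lt.1 ht).2)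
  refine hd.congr_of_eventuallyEq ?_
  filter_upwards [(continuous_abs.tendsto t).eventually (gt_mem_nhds ht)] with s hs
  exact key s _ hs

/-- Joint continuity of the solution in the initial value and in time. -/
theorem continuous_of_isFlow [FiniteDimensional ℝ X] {f : X → X} (hf : ContDiff ℝ 1 f)
    (hb : ∃ K, ∀ x, ‖f x‖ ≤ K) {φ : ℝ → X → X} (h0 : ∀ x, φ 0 x = x)
    (hφ : ∀ x t, HasDerivAt (fun s => φ s x) (f (φ t x)) t) :
    Continuous fun p : ℝ × X => φ p.1 p.2 := by
  rw [continuous_iff_continuousAt]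
  rintro ⟨t₀, x₀⟩
  have hT : 0 < |t₀| + 1 := by positivity
  obtain ⟨α, hα, hc⟩ := exists_local hf hb x₀ hT
  have hmem : Metric.closedBall x₀ 1 ×ˢ Icc (-(|t₀| + 1)) (|t₀| + 1) ∈ 𝓝 (x₀, t₀) :=
    prod_mem_nhds (Metric.closedBall_mem_nhds _ one_pos)
      (Icc_mem_nhds (by linarith [neg_abs_le t₀]) (by linarith [le_abs_self t₀]))
  have h1 : ContinuousAt (fun p : X × ℝ => φ p.2 p.1) (x₀, t₀) := by
    refine (hc.continuousAt hmem).congr ?_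
    filter_upwards [hmem] with p hp
    exact unique hf hT (hα p.1 hp.1).2 (fun t _ => (hφ p.1 t).hasDerivWithinAt)
      ((hα p.1 hp.1).1.trans (h0 p.1).symm) hp.2
  exact ContinuousAt.comp (f := fun p : ℝ × X => (p.2, p.1))
    (g := fun p : X × ℝ => φ p.2 p.1) h1 continuous_swap.continuousAt

end BoundedFlow

/-! ### The data of the piecewise deterministic Markov process -/

/-- The data on `ℝ^d × E`, `E = {0, …, m}`: bounded smooth vector fields `F i`, the intensity
`rate` of the Poisson process of jump times, and a continuous family `Q x` of irreducible aperiodic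
Markov transition matrices on `E`. -/
structure PDMP (d m : ℕ) where
  F : Fin (m + 1) → EuclideanSpace ℝ (Fin d) → EuclideanSpace ℝ (Fin d)
  smooth : ∀ i, ContDiff ℝ (⊤ : ℕ∞) (F i)
  bounded : ∀ i, ∃ K : ℝ, ∀ x, ‖F i x‖ ≤ K
  rate : ℝ
  rate_pos : 0 < rate
  Q : EuclideanSpace ℝ (Fin d) → Matrix (Fin (m + 1)) (Fin (m + 1)) ℝ
  continuous_Q : Continuous Q
  Q_nonneg : ∀ x i j, 0 ≤ Q x i j
  Q_sum : ∀ x i, ∑ j, Q x i j = 1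
  Q_irreducible_aperiodic : ∀ x, ∃ n : ℕ, ∀ i j, 0 < (Q x ^ n) i j

namespace PDMP

variable {d m : ℕ} (P : PDMP d m)

theorem contDiff_one (i : Fin (m + 1)) : ContDiff ℝ 1 (P.F i) :=
  (P.smooth i).of_le (by exact_mod_cast le_top)

/-- The flow `Φ^i(t, x)` of the vector field `F^i`. -/
def flow (i : Fin (m + 1)) (t : ℝ) (x : EuclideanSpace ℝ (Fin d)) : EuclideanSpace ℝ (Fin d) :=
  (BoundedFlow.exists_global (P.contDiff_one i) (P.bounded i) x).choose t

theorem flow_zero (i : Fin (m + 1)) (x : EuclideanSpace ℝ (Fin d)) : P.flow i 0 x = x :=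
  (BoundedFlow.exists_global (P.contDiff_one i) (P.bounded i) x).choose_spec.1

theorem hasDerivAt_flow (i : Fin (m + 1)) (x : EuclideanSpace ℝ (Fin d)) (t : ℝ) :
    HasDerivAt (fun s => P.flow i s x) (P.F i (P.flow i t x)) t :=
  (BoundedFlow.exists_global (P.contDiff_one i) (P.bounded i) x).choose_spec.2 t

theorem continuous_flow (i : Fin (m + 1)) :
    Continuous fun p : ℝ × EuclideanSpace ℝ (Fin d) => P.flow i p.1 p.2 :=
  BoundedFlow.continuous_of_isFlow (P.contDiff_one i) (P.bounded i) (P.flow_zero i)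
    (P.hasDerivAt_flow i)

/-! ### The process -/

/-- A step `(U_n, X̃_n, Ỹ_n)` of the embedded chain: the waiting time before the `n`-th jump, the
position at that jump, and the mode after it. -/
abbrev Step (d m : ℕ) : Type := ℝ × EuclideanSpace ℝ (Fin d) × Fin (m + 1)

/-- Move along the flow of the current mode: `(s, u) ↦ (u, Φ^{s.mode}(u, s.position), s.mode)`. -/
def move (p : Step d m × ℝ) : Step d m :=
  (p.2, P.flow p.1.2.2 p.2 p.1.2.1, p.1.2.2)

theorem measurable_move : Measurable P.move := by
  have h : Measurable fun q : (ℝ × EuclideanSpace ℝ (Fin d)) × Fin (m + 1) =>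
      P.flow q.2 q.1.1 q.1.2 :=
    measurable_from_prod_countable_left fun i => (P.continuous_flow i).measurable
  have h' : Measurable fun p : Step d m × ℝ => P.flow p.1.2.2 p.2 p.1.2.1 :=
    h.comp (g := fun q : (ℝ × EuclideanSpace ℝ (Fin d)) × Fin (m + 1) => P.flow q.2 q.1.1 q.1.2)
      (f := fun p : Step d m × ℝ => ((p.2, p.1.2.1), p.1.2.2)) (by fun_prop)
  unfold move
  fun_prop

/-- The exponential law of the waiting times. -/
def waitingLaw : Measure ℝ := expMeasure P.rate

instance : IsProbabilityMeasure P.waitingLaw := isProbabilityMeasure_expMeasure P.rate_pos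

/-- Wait for an independent exponential time while following the flow of the current mode. -/
def waitKernel : Kernel (Step d m) (Step d m) :=
  (Kernel.id ×ₖ Kernel.const (Step d m) P.waitingLaw).map P.move

instance : IsMarkovKernel P.waitKernel :=
  Kernel.IsMarkovKernel.map _ P.measurable_move

/-- At position `x` in mode `i`, switch to mode `j` with probability `Q(x, i, j)`. -/
def switchKernel : Kernel (Step d m) (Step d m) where
  toFun s := ∑ j, ENNReal.ofReal (P.Q s.2.1 s.2.2 j) • Measure.dirac (s.1, s.2.1, j)
  measurable' := by
    have hQ : ∀ j, Measurable fun s : Step d m => P.Q s.2.1 s.2.2 j := by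
      intro j
      have h : Measurable fun q : EuclideanSpace ℝ (Fin d) × Fin (m + 1) => P.Q q.1 q.2 j :=
        measurable_from_prod_countable_left fun i =>
          (P.continuous_Q.matrix_elem i j).measurable
      exact h.comp measurable_snd
    refine Measure.measurable_of_measurable_coe _ fun A hA => ?_
    simp only [Measure.coe_finsetSum, Finset.sum_apply, Measure.smul_apply, smul_eq_mul]
    refine Finset.measurable_sum _ fun j _ => ((hQ j).ennreal_ofReal).mul ?_
    exact (Measure.measurable_coe hA).comp
      (Measure.measurable_dirac.comp (by fun_prop))

instance : IsMarkovKernel P.switchKernel := by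
  refine ⟨fun s => ⟨?_⟩⟩
  change (∑ j, ENNReal.ofReal (P.Q s.2.1 s.2.2 j) • Measure.dirac (s.1, s.2.1, j)) univ = 1
  simp only [Measure.coe_finsetSum, Finset.sum_apply, Measure.smul_apply, smul_eq_mul,
    measure_univ, mul_one]
  rw [← ENNReal.ofReal_sum_of_nonneg fun j _ => P.Q_nonneg _ _ j, P.Q_sum, ENNReal.ofReal_one]

/-- The transition kernel of the embedded chain: wait, then switch. -/
def stepKernel : Kernel (Step d m) (Step d m) := P.switchKernel ∘ₖ P.waitKernel

instance : IsMarkovKernel P.stepKernel := by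
  unfold stepKernel
  infer_instance

/-- `P_{x,i}`: the law of the embedded Markov chain `(U_n, X̃_n, Ỹ_n)_{n ≥ 0}` with `X̃_0 = x` and
`Ỹ_0 = i`. The coordinate `U_0` plays no role and is put equal to `0`. -/
def law (x : EuclideanSpace ℝ (Fin d)) (i : Fin (m + 1)) : Measure (ℕ → Step d m) :=
  Kernel.trajMeasure (X := fun _ => Step d m) (Measure.dirac (0, x, i))
    (fun n => P.stepKernel.comap
      (fun h : (k : Finset.Iic n) → Step d m => h ⟨n, Finset.mem_Iic.2 le_rfl⟩)
      (measurable_pi_apply _))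

/-- The jump time `T_n = U_1 + ⋯ + U_n`. -/
def jumpTime (n : ℕ) (ω : ℕ → Step d m) : ℝ := ∑ k ∈ Finset.range n, (ω (k + 1)).1

/-- The number `N_t` of jumps up to time `t`, i.e. the `n` with `T_n ≤ t < T_{n+1}`. -/
def jumpCount (t : ℝ) (ω : ℕ → Step d m) : ℕ := sSup {n | jumpTime n ω ≤ t}

/-- The process `Z_t = (X_t, Y_t) = (Φ^{Ỹ_n}(t - T_n, X̃_n), Ỹ_n)` for `T_n ≤ t < T_{n+1}`. -/
def process (t : ℝ) (ω : ℕ → Step d m) : EuclideanSpace ℝ (Fin d) × Fin (m + 1) :=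
  (P.flow (ω (jumpCount t ω)).2.2 (t - jumpTime (jumpCount t ω) ω) (ω (jumpCount t ω)).2.1,
    (ω (jumpCount t ω)).2.2)

end PDMP

/-! ### The associated control system `x' = ∑ v_i(t) F^i(x)` -/

namespace ControlSystem

variable {d m : ℕ}

/-- The control range `S`, the canonical basis of `ℝ^{m+1}`. -/
def switchingRange (m : ℕ) : Set (Fin (m + 1) → ℝ) :=
  {v | ∑ i, v i = 1 ∧ ∀ i, v i = 0 ∨ v i = 1}

/-- The control range `co(S)`, the unit `m`-simplex. -/
def convexRange (m : ℕ) : Set (Fin (m + 1) → ℝ) :=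
  {v | ∑ i, v i = 1 ∧ ∀ i, v i ∈ Icc (0 : ℝ) 1}

variable (F : Fin (m + 1) → EuclideanSpace ℝ (Fin d) → EuclideanSpace ℝ (Fin d))
  (V : Set (Fin (m + 1) → ℝ))

/-- Measurable control functions on `[0, ∞)` with values in `V`. -/
def IsControl (v : ℝ → Fin (m + 1) → ℝ) : Prop :=
  Measurable v ∧ ∀ t, 0 ≤ t → v t ∈ V

/-- `φ = φ(·, x, v)` on `[0, ∞)`: the (absolutely continuous) solution with `φ 0 = x`, in the
integrated form. -/
def IsTrajectory (v : ℝ → Fin (m + 1) → ℝ) (x : EuclideanSpace ℝ (Fin d))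
    (φ : ℝ → EuclideanSpace ℝ (Fin d)) : Prop :=
  ContinuousOn φ (Ici 0) ∧ ∀ t, 0 ≤ t → φ t = x + ∫ s in (0 : ℝ)..t, ∑ i, v s i • F i (φ s)

/-- The reachable set up to time `T`. -/
def reachableUpTo (T : ℝ) (x : EuclideanSpace ℝ (Fin d)) : Set (EuclideanSpace ℝ (Fin d)) :=
  {y | ∃ t ∈ Icc (0 : ℝ) T, ∃ v, IsControl V v ∧ ∃ φ, IsTrajectory F v x φ ∧ φ t = y}

/-- The reachable set `O⁺(x)`. -/
def reachable (x : EuclideanSpace ℝ (Fin d)) : Set (EuclideanSpace ℝ (Fin d)) :=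
  ⋃ T : ℝ, ⋃ _ : 0 < T, reachableUpTo F V T x

/-- Controlled invariance: from every point of `D` some control keeps the trajectory in `D`. -/
def IsControlledInvariant (D : Set (EuclideanSpace ℝ (Fin d))) : Prop :=
  ∀ x ∈ D, ∃ v, IsControl V v ∧ ∃ φ, IsTrajectory F v x φ ∧ ∀ t, 0 ≤ t → φ t ∈ D

/-- Control sets: maximal nonempty controlled invariant sets of approximate controllability. -/
def IsControlSet (D : Set (EuclideanSpace ℝ (Fin d))) : Prop :=
  Maximal (fun D' : Set (EuclideanSpace ℝ (Fin d)) => D'.Nonempty ∧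
    IsControlledInvariant F V D' ∧ ∀ x ∈ D', D' ⊆ closure (reachable F V x)) D

/-- Invariant control sets. -/
def IsInvariantControlSet (C : Set (EuclideanSpace ℝ (Fin d))) : Prop :=
  IsControlSet F V C ∧ ∀ x ∈ C, closure C = closure (reachable F V x)

/-- The domain of attraction `A(C)`. -/
def domainOfAttraction (C : Set (EuclideanSpace ℝ (Fin d))) : Set (EuclideanSpace ℝ (Fin d)) :=
  {x | (closure (reachable F V x) ∩ C).Nonempty}

end ControlSystem

end

/-!
The proof separates topology from probability.

Let `O` be the interior of `C`. The set `P.hitSet O` consists of the positions from which `O` is hit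
at some exact time `t`, for every initial mode, along a path that follows the flows and whose jumps
have positive probability. It is open, it contains `O`, and it is backward invariant under each of
the flows. The initial mode is immaterial because an irreducible `Q x` allows a finite chain of
jumps between any two modes, and these jumps can be made arbitrarily fast, the small error in time
and position being absorbed by openness (`CanHit.of_mode`).

The complement of such a set is closed and forward invariant under each of the flows, hence under
the control system with control range the simplex (`mem_of_isTrajectory_of_isClosed`). Indeed, at a
nearest point of the closed set each `F i` has nonpositive component along the outer normal, and so
has every convex combination; by Grönwall's inequality the squared distance of a trajectory to the
set stays zero. No approximation of measurable controls by switching ones is needed.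
Consequently, if the control system reaches `P.hitSet O` from a point, that point belongs to it.
For `x` in the domain of attraction some `z ∈ C` lies in the closure of the reachable set of `x`,
and `O` meets the reachable set of `z`: thus `z`, and then `x`, belongs to `P.hitSet O`.

Finally, jump paths lie in the support of the law of the embedded chain (`IsJumpPath.law_pos`),
since the step kernel charges every neighbourhood of the next step from all steps near the present
one. The event that exactly `n` jumps occur before `t` and that the process is in `O` at time `t`
contains an open set of paths around the jump path, up to the null set where some waiting time is
negative, so it has positive probability. Finitely many initial modes give a common lower bound.
-/

open scoped RealInnerProductSpace

/-! ### Invariant closed sets of the control system -/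

namespace ControlSystem

variable {d m : ℕ}

theorem mem_convexRange_of_mem {V : Set (Fin (m + 1) → ℝ)}
    (hV : V = switchingRange m ∨ V = convexRange m) {v : Fin (m + 1) → ℝ} (hv : v ∈ V) :
    v ∈ convexRange m := by
  rcases hV with rfl | rfl
  · refine ⟨hv.1, fun i => ?_⟩
    rcases hv.2 i with h | h <;> simp [h]
  · exact hv

theorem norm_velocity_le {F : Fin (m + 1) → EuclideanSpace ℝ (Fin d) → EuclideanSpace ℝ (Fin d)}
    {K : ℝ} (hK : ∀ i x, ‖F i x‖ ≤ K) {v : Fin (m + 1) → ℝ} (hv : v ∈ convexRange m)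
    (x : EuclideanSpace ℝ (Fin d)) : ‖∑ i, v i • F i x‖ ≤ K := by
  calc ‖∑ i, v i • F i x‖ ≤ ∑ i, v i * K := by
        refine norm_sum_le_of_le _ fun i _ => ?_
        rw [norm_smul, Real.norm_of_nonneg (hv.2 i).1]
        exact mul_le_mul_of_nonneg_left (hK i x) (hv.2 i).1
    _ = K := by rw [← Finset.sum_mul, hv.1, one_mul]

theorem intervalIntegrable_velocity
    {F : Fin (m + 1) → EuclideanSpace ℝ (Fin d) → EuclideanSpace ℝ (Fin d)}
    (hF : ∀ i, Continuous (F i)) {K : ℝ} (hK : ∀ i x, ‖F i x‖ ≤ K)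
    {v : ℝ → Fin (m + 1) → ℝ} (hv : IsControl (convexRange m) v)
    {φ : ℝ → EuclideanSpace ℝ (Fin d)} (hφ : ContinuousOn φ (Ici 0)) {a b : ℝ}
    (ha : 0 ≤ a) (hab : a ≤ b) :
    IntervalIntegrable (fun s => ∑ i, v s i • F i (φ s)) volume a b := by
  rw [intervalIntegrable_iff_integrableOn_Ioc_of_le hab]
  have hsub : Ioc a b ⊆ Ici 0 := fun s hs => ha.trans hs.1.le
  refine IntegrableOn.of_bound measure_Ioc_lt_top ?_ K ?_
  · refine Finset.aestronglyMeasurable_fun_sum _ fun i _ => ?_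
    refine ((measurable_pi_apply i).comp hv.1).aestronglyMeasurable.smul ?_
    exact (((hF i).comp_continuousOn hφ).mono hsub).aestronglyMeasurable measurableSet_Ioc
  · filter_upwards [ae_restrict_mem measurableSet_Ioc] with s hs
    exact norm_velocity_le hK (hv.2 s (hsub hs)) _

theorem IsTrajectory.sub_eq {F : Fin (m + 1) → EuclideanSpace ℝ (Fin d) → EuclideanSpace ℝ (Fin d)}
    (hF : ∀ i, Continuous (F i)) {K : ℝ} (hK : ∀ i x, ‖F i x‖ ≤ K)
    {v : ℝ → Fin (m + 1) → ℝ} (hv : IsControl (convexRange m) v)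
    {x : EuclideanSpace ℝ (Fin d)} {φ : ℝ → EuclideanSpace ℝ (Fin d)}
    (hφ : IsTrajectory F v x φ) {a b : ℝ} (ha : 0 ≤ a) (hab : a ≤ b) :
    φ b - φ a = ∫ s in a..b, ∑ i, v s i • F i (φ s) := by
  rw [hφ.2 b (ha.trans hab), hφ.2 a ha, add_sub_add_left_eq_sub,
    intervalIntegral.integral_interval_sub_left
      (intervalIntegrable_velocity hF hK hv hφ.1 le_rfl (ha.trans hab))
      (intervalIntegrable_velocity hF hK hv hφ.1 le_rfl ha)]

theorem IsTrajectory.norm_sub_le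
    {F : Fin (m + 1) → EuclideanSpace ℝ (Fin d) → EuclideanSpace ℝ (Fin d)}
    (hF : ∀ i, Continuous (F i)) {K : ℝ} (hK : ∀ i x, ‖F i x‖ ≤ K)
    {v : ℝ → Fin (m + 1) → ℝ} (hv : IsControl (convexRange m) v)
    {x : EuclideanSpace ℝ (Fin d)} {φ : ℝ → EuclideanSpace ℝ (Fin d)}
    (hφ : IsTrajectory F v x φ) {a b : ℝ} (ha : 0 ≤ a) (hab : a ≤ b) :
    ‖φ b - φ a‖ ≤ K * (b - a) := by
  rw [hφ.sub_eq hF hK hv ha hab, ← abs_of_nonneg (sub_nonneg.2 hab)]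
  refine intervalIntegral.norm_integral_le_of_norm_le_const fun s hs => ?_
  rw [uIoc_of_le hab] at hs
  exact norm_velocity_le hK (hv.2 s (ha.trans hs.1.le)) _

theorem IsTrajectory.zero_eq
    {F : Fin (m + 1) → EuclideanSpace ℝ (Fin d) → EuclideanSpace ℝ (Fin d)}
    {v : ℝ → Fin (m + 1) → ℝ} {x : EuclideanSpace ℝ (Fin d)} {φ : ℝ → EuclideanSpace ℝ (Fin d)}
    (hφ : IsTrajectory F v x φ) : φ 0 = x := by
  simpa using hφ.2 0 le_rfl

end ControlSystem

namespace PDMP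

variable {d m : ℕ} (P : PDMP d m)

theorem exists_bound : ∃ K : ℝ, ∀ i x, ‖P.F i x‖ ≤ K := by
  choose K hK using P.bounded
  refine ⟨∑ i, K i, fun i x => (hK i x).trans ?_⟩
  exact Finset.single_le_sum (fun j _ => (norm_nonneg _).trans (hK j x)) (Finset.mem_univ i)

theorem exists_lipschitz {s : Set (EuclideanSpace ℝ (Fin d))} (hs : IsCompact s) :
    ∃ L : ℝ, 0 ≤ L ∧ ∀ i, ∀ x ∈ s, ∀ y ∈ s, ‖P.F i x - P.F i y‖ ≤ L * ‖x - y‖ := by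
  have h : ∀ i, ∃ L : NNReal, LipschitzOnWith L (P.F i) s := fun i =>
    (P.contDiff_one i).locallyLipschitz.locallyLipschitzOn.exists_lipschitzOnWith_of_compact hs
  choose L hL using h
  refine ⟨∑ i, (L i : ℝ), Finset.sum_nonneg fun i _ => (L i).2, fun i x hx y hy => ?_⟩
  refine ((hL i).norm_sub_le hx hy).trans (mul_le_mul_of_nonneg_right ?_ (norm_nonneg _))
  exact Finset.single_le_sum (f := fun j => (L j : ℝ)) (fun j _ => (L j).2) (Finset.mem_univ i)

/-- At a point `y` of a set that is forward invariant under the flow of `F i`, the field `F i`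
points away from every outer normal vector `p`. -/
theorem inner_le_zero_of_forwardInvariant {H : Set (EuclideanSpace ℝ (Fin d))} {i : Fin (m + 1)}
    (hH : ∀ t, 0 ≤ t → ∀ x ∈ H, P.flow i t x ∈ H) {y p : EuclideanSpace ℝ (Fin d)} (hy : y ∈ H)
    (hp : ∀ z ∈ H, ‖p‖ ≤ ‖y + p - z‖) : ⟪p, P.F i y⟫ ≤ 0 := by
  have hd : HasDerivAt (fun s => ‖y + p - P.flow i s y‖ ^ 2) (2 * ⟪p, -P.F i y⟫) 0 := by
    have h := ((P.hasDerivAt_flow i y 0).const_sub (y + p)).norm_sq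
    simpa [P.flow_zero] using h
  have hslope := (hasDerivAt_iff_tendsto_slope.1 hd).mono_left
    (nhdsWithin_mono (0 : ℝ) fun s (hs : s ∈ Ioi (0 : ℝ)) => (ne_of_gt hs : s ≠ 0))
  have hge : 0 ≤ 2 * ⟪p, -P.F i y⟫ := by
    refine ge_of_tendsto hslope ?_
    filter_upwards [self_mem_nhdsWithin] with s hs
    rw [slope_def_field]
    refine div_nonneg (sub_nonneg.2 ?_) (sub_nonneg.2 (le_of_lt hs))
    rw [P.flow_zero, add_sub_cancel_left]
    exact pow_le_pow_left₀ (norm_nonneg _) (hp _ (hH s (le_of_lt hs) y hy)) 2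
  rw [inner_neg_right] at hge
  linarith

/-- Along a controlled trajectory, the squared distance `D` to a closed flow-invariant set has
increments at most `(s - t) * (L * D t + B * (s - t))`: at the point nearest to `φ t` every convex
combination of the fields has nonpositive component along the outer normal, so only the Lipschitz
defect between `φ` and that point contributes to first order. -/
theorem infDist_sq_sub_le {H : Set (EuclideanSpace ℝ (Fin d))} (hHc : IsClosed H)
    (hH : ∀ i, ∀ t, 0 ≤ t → ∀ x ∈ H, P.flow i t x ∈ H)
    {v : ℝ → Fin (m + 1) → ℝ} (hv : ControlSystem.IsControl (ControlSystem.convexRange m) v)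
    {x : EuclideanSpace ℝ (Fin d)} (hx : x ∈ H) {φ : ℝ → EuclideanSpace ℝ (Fin d)}
    (hφ : ControlSystem.IsTrajectory P.F v x φ) (T : ℝ) :
    ∃ L B : ℝ, ∀ t s, 0 ≤ t → t ≤ s → s ≤ T →
      Metric.infDist (φ s) H ^ 2 - Metric.infDist (φ t) H ^ 2 ≤
        (s - t) * (L * Metric.infDist (φ t) H ^ 2 + B * (s - t)) := by
  obtain ⟨K, hK⟩ := P.exists_bound
  have hK0 : 0 ≤ K := (norm_nonneg _).trans (hK 0 x)
  have hF : ∀ i, Continuous (P.F i) := fun i => (P.smooth i).continuous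
  -- This ball contains the trajectory up to time `T` and the points of `H` nearest to it.
  obtain ⟨L, hL0, hL⟩ := P.exists_lipschitz (isCompact_closedBall x (2 * (K * T)))
  refine ⟨2 * L, 2 * (K * T) * L * K + K ^ 2, fun t s ht hts hsT => ?_⟩
  have hφball : ∀ r, 0 ≤ r → r ≤ T → ‖φ r - x‖ ≤ K * T := by
    intro r hr hrT
    have h := hφ.norm_sub_le hF hK hv le_rfl hr
    rw [hφ.zero_eq, sub_zero] at h
    exact h.trans (mul_le_mul_of_nonneg_left hrT hK0)
  have hKT : 0 ≤ K * T := (norm_nonneg _).trans (hφball t ht (hts.trans hsT))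
  obtain ⟨y, hyH, hy⟩ := hHc.exists_infDist_eq_dist ⟨x, hx⟩ (φ t)
  obtain ⟨p, hp⟩ : ∃ p, p = φ t - y := ⟨_, rfl⟩
  obtain ⟨q, hq⟩ : ∃ q, q = φ s - φ t := ⟨_, rfl⟩
  rw [dist_eq_norm, ← hp] at hy
  have hpT : ‖p‖ ≤ K * T := by
    rw [← hy]
    refine (Metric.infDist_le_dist_of_mem hx).trans ?_
    rw [dist_eq_norm]
    exact hφball t ht (hts.trans hsT)
  have hyball : y ∈ Metric.closedBall x (2 * (K * T)) := by
    rw [mem_closedBall_iff_norm, show y - x = (φ t - x) - p by rw [hp]; abel]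
    linarith [norm_sub_le (φ t - x) p, hφball t ht (hts.trans hsT)]
  have hnormal : ∀ i, ⟪p, P.F i y⟫ ≤ 0 := by
    refine fun i => P.inner_le_zero_of_forwardInvariant (hH i) hyH fun z hz => ?_
    rw [← hy, show y + p - z = φ t - z by rw [hp]; abel, ← dist_eq_norm]
    exact Metric.infDist_le_dist_of_mem hz
  have hqn : ‖q‖ ≤ K * (s - t) := hq ▸ hφ.norm_sub_le hF hK hv ht hts
  have hvel : ∀ r ∈ Icc t s,
      ⟪p, ∑ i, v r i • P.F i (φ r)⟫ ≤ ‖p‖ * (L * (‖p‖ + K * (s - t))) := by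
    intro r hr
    have hvr := hv.2 r (ht.trans hr.1)
    have hφr : φ r ∈ Metric.closedBall x (2 * (K * T)) := by
      rw [mem_closedBall_iff_norm]
      linarith [hφball r (ht.trans hr.1) (hr.2.trans hsT)]
    have hdist : ‖φ r - y‖ ≤ ‖p‖ + K * (s - t) := by
      rw [show φ r - y = p + (φ r - φ t) by rw [hp]; abel]
      have h1 := hφ.norm_sub_le hF hK hv ht hr.1
      have h2 : K * (r - t) ≤ K * (s - t) :=
        mul_le_mul_of_nonneg_left (by linarith [hr.2]) hK0
      linarith [norm_add_le p (φ r - φ t)]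
    have hterm : ∀ i, ⟪p, P.F i (φ r)⟫ ≤ ‖p‖ * (L * (‖p‖ + K * (s - t))) := by
      intro i
      have h1 : ⟪p, P.F i (φ r)⟫ = ⟪p, P.F i y⟫ + ⟪p, P.F i (φ r) - P.F i y⟫ := by
        rw [inner_sub_right]; ring
      have h2 : ⟪p, P.F i (φ r) - P.F i y⟫ ≤ ‖p‖ * ‖P.F i (φ r) - P.F i y‖ :=
        real_inner_le_norm _ _
      have h3 : ‖p‖ * ‖P.F i (φ r) - P.F i y‖ ≤ ‖p‖ * (L * (‖p‖ + K * (s - t))) := by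
        refine mul_le_mul_of_nonneg_left ((hL i _ hφr _ hyball).trans ?_) (norm_nonneg _)
        exact mul_le_mul_of_nonneg_left hdist hL0
      linarith [hnormal i]
    calc ⟪p, ∑ i, v r i • P.F i (φ r)⟫ = ∑ i, v r i * ⟪p, P.F i (φ r)⟫ := by
          simp only [inner_sum, real_inner_smul_right]
      _ ≤ ∑ i, v r i * (‖p‖ * (L * (‖p‖ + K * (s - t)))) :=
          Finset.sum_le_sum fun i _ => mul_le_mul_of_nonneg_left (hterm i) (hvr.2 i).1
      _ = ‖p‖ * (L * (‖p‖ + K * (s - t))) := by rw [← Finset.sum_mul, hvr.1, one_mul]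
  have hpq : ⟪p, q⟫ ≤ (s - t) * (‖p‖ * (L * (‖p‖ + K * (s - t)))) := by
    have hint := ControlSystem.intervalIntegrable_velocity hF hK hv hφ.1 ht hts
    have h1 : ⟪p, q⟫ = ∫ r in t..s, ⟪p, ∑ i, v r i • P.F i (φ r)⟫ := by
      rw [hq, hφ.sub_eq hF hK hv ht hts]
      exact ((innerSL ℝ p).intervalIntegral_comp_comm hint).symm
    rw [h1]
    refine (intervalIntegral.integral_mono_on hts
      ⟨(innerSL ℝ p).integrable_comp hint.1, (innerSL ℝ p).integrable_comp hint.2⟩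
      intervalIntegrable_const hvel).trans_eq ?_
    rw [intervalIntegral.integral_const, smul_eq_mul]
  have hdist : Metric.infDist (φ s) H ^ 2 ≤ ‖p + q‖ ^ 2 := by
    refine pow_le_pow_left₀ Metric.infDist_nonneg ?_ 2
    rw [show p + q = φ s - y by rw [hp, hq]; abel, ← dist_eq_norm]
    exact Metric.infDist_le_dist_of_mem hyH
  rw [norm_add_sq_real] at hdist
  have hst : 0 ≤ s - t := sub_nonneg.2 hts
  have hq2 : ‖q‖ ^ 2 ≤ (K * (s - t)) ^ 2 := pow_le_pow_left₀ (norm_nonneg _) hqn 2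
  have hp2 : ‖p‖ * (L * K * (s - t) ^ 2) ≤ K * T * (L * K * (s - t) ^ 2) :=
    mul_le_mul_of_nonneg_right hpT (by positivity)
  rw [hy]
  nlinarith [hdist, hpq, hq2, hp2]

/-- A closed set that is forward invariant under each of the flows is forward invariant under the
control system with convexified control range. -/
theorem mem_of_isTrajectory_of_isClosed {H : Set (EuclideanSpace ℝ (Fin d))} (hHc : IsClosed H)
    (hH : ∀ i, ∀ t, 0 ≤ t → ∀ x ∈ H, P.flow i t x ∈ H)
    {v : ℝ → Fin (m + 1) → ℝ} (hv : ControlSystem.IsControl (ControlSystem.convexRange m) v)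
    {x : EuclideanSpace ℝ (Fin d)} (hx : x ∈ H) {φ : ℝ → EuclideanSpace ℝ (Fin d)}
    (hφ : ControlSystem.IsTrajectory P.F v x φ) {T : ℝ} (hT : 0 ≤ T) : φ T ∈ H := by
  obtain ⟨L, B, hLB⟩ := P.infDist_sq_sub_le hHc hH hv hx hφ T
  have hcont : ContinuousOn (fun t => Metric.infDist (φ t) H ^ 2) (Icc 0 T) :=
    (((Metric.continuous_infDist_pt H).comp_continuousOn hφ.1).pow 2).mono Icc_subset_Ici_self
  have h := le_gronwallBound_of_liminf_deriv_right_le (K := L) (ε := 0) (δ := 0)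
    (f' := fun t => L * Metric.infDist (φ t) H ^ 2) hcont ?_ ?_ (fun t _ => by simp) T ⟨hT, le_rfl⟩
  · rw [gronwallBound_ε0_δ0] at h
    have h0 : Metric.infDist (φ T) H = 0 := by
      exact pow_eq_zero_iff two_ne_zero |>.1 (le_antisymm h (sq_nonneg _))
    exact (hHc.mem_iff_infDist_zero ⟨x, hx⟩).2 h0
  · intro t ⟨ht0, htT⟩ r hr
    refine Eventually.frequently ?_
    have hlim : Tendsto (fun s => L * Metric.infDist (φ t) H ^ 2 + B * (s - t)) (𝓝[>] t)
        (𝓝 (L * Metric.infDist (φ t) H ^ 2 + B * (t - t))) :=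
      Continuous.tendsto (by fun_prop) t |>.mono_left nhdsWithin_le_nhds
    rw [sub_self, mul_zero, add_zero] at hlim
    filter_upwards [hlim.eventually (gt_mem_nhds hr), Ioc_mem_nhdsGT htT] with s hs hst
    refine lt_of_le_of_lt ?_ hs
    rw [inv_mul_le_iff₀ (sub_pos.2 hst.1)]
    exact hLB t s ht0 hst.1.le hst.2
  · simp [hφ.zero_eq, Metric.infDist_zero_of_mem hx]

/-- An open set that is backward invariant under each of the flows contains every point from which
the control system can reach it. -/
theorem mem_of_reachable_inter_nonempty {V : Set (Fin (m + 1) → ℝ)}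
    (hV : V = ControlSystem.switchingRange m ∨ V = ControlSystem.convexRange m)
    {G : Set (EuclideanSpace ℝ (Fin d))} (hG : IsOpen G)
    (hinv : ∀ i, ∀ t, 0 ≤ t → ∀ x, P.flow i t x ∈ G → x ∈ G) {x : EuclideanSpace ℝ (Fin d)}
    (hx : (ControlSystem.reachable P.F V x ∩ G).Nonempty) : x ∈ G := by
  obtain ⟨y, hy, hyG⟩ := hx
  simp only [ControlSystem.reachable, mem_iUnion] at hy
  obtain ⟨-, -, t, ⟨ht0, -⟩, v, hv, φ, hφ, rfl⟩ := hy
  by_contra hxG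
  exact P.mem_of_isTrajectory_of_isClosed hG.isClosed_compl
    (fun i s hs z hz hzG => hz (hinv i s hs z hzG))
    ⟨hv.1, fun s hs => ControlSystem.mem_convexRange_of_mem hV (hv.2 s hs)⟩ hxG hφ ht0 hyG

end PDMP

/-! ### Jump paths that hit an open set -/

namespace PDMP

variable {d m : ℕ} (P : PDMP d m)

/-- From the position `x` and the mode `i`, the set `O` is hit at time exactly `t` along a path that
follows the flows and has finitely many jumps, the waiting times being positive and every jump
having positive probability under `Q` at the place where it occurs. -/
inductive CanHit (O : Set (EuclideanSpace ℝ (Fin d))) :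
    ℝ → EuclideanSpace ℝ (Fin d) → Fin (m + 1) → Prop
  | flow {t : ℝ} {x : EuclideanSpace ℝ (Fin d)} {i : Fin (m + 1)} :
      0 < t → P.flow i t x ∈ O → CanHit O t x i
  | jump {t u : ℝ} {x : EuclideanSpace ℝ (Fin d)} {i j : Fin (m + 1)} :
      0 < u → 0 < P.Q (P.flow i u x) i j → CanHit O (t - u) (P.flow i u x) j → CanHit O t x i

variable {P} {O : Set (EuclideanSpace ℝ (Fin d))}

theorem CanHit.pos {t : ℝ} {x : EuclideanSpace ℝ (Fin d)} {i : Fin (m + 1)}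
    (h : P.CanHit O t x i) : 0 < t := by
  induction h with
  | flow ht _ => exact ht
  | jump hu _ _ ih => linarith

theorem continuous_flow_apply (i : Fin (m + 1)) (t : ℝ) : Continuous (P.flow i t) :=
  (P.continuous_flow i).comp (by fun_prop : Continuous fun x => (t, x))

theorem CanHit.eventually (hO : IsOpen O) {t : ℝ} {x : EuclideanSpace ℝ (Fin d)}
    {i : Fin (m + 1)} (h : P.CanHit O t x i) :
    ∀ᶠ p in 𝓝 (t, x), P.CanHit O p.1 p.2 i := by
  induction h with
  | @flow t x i ht hx =>
    filter_upwards [continuous_fst.tendsto (t, x) |>.eventually (lt_mem_nhds ht),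
      (P.continuous_flow i).tendsto (t, x) |>.eventually (hO.mem_nhds hx)] with p h1 h2
    exact .flow h1 h2
  | @jump t u x i j hu hQ _ ih =>
    have hc : Continuous fun p : ℝ × EuclideanSpace ℝ (Fin d) => (p.1 - u, P.flow i u p.2) :=
      (continuous_fst.sub continuous_const).prodMk
        ((continuous_flow_apply i u).comp continuous_snd)
    have hcQ : Continuous fun p : ℝ × EuclideanSpace ℝ (Fin d) => P.Q (P.flow i u p.2) i j :=
      (P.continuous_Q.matrix_elem i j).comp ((continuous_flow_apply i u).comp continuous_snd)
    filter_upwards [hc.tendsto (t, x) |>.eventually ih,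
      hcQ.tendsto (t, x) |>.eventually (lt_mem_nhds hQ)] with p h1 h2
    exact .jump hu h2 h1

/-- The mode may be changed at the start at no cost in time: a jump after a short wait is
compensated by the openness of `CanHit` in time and position. -/
theorem CanHit.of_Q_pos (hO : IsOpen O) {t : ℝ} {x : EuclideanSpace ℝ (Fin d)}
    {i j : Fin (m + 1)} (hQ : 0 < P.Q x i j) (h : P.CanHit O t x j) : P.CanHit O t x i := by
  have hflow : Continuous fun u => P.flow i u x :=
    (P.continuous_flow i).comp (by fun_prop : Continuous fun u => (u, x))
  have hc : Tendsto (fun u => (t - u, P.flow i u x)) (𝓝[>] 0) (𝓝 (t, x)) := by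
    have h0 : Continuous fun u => (t - u, P.flow i u x) :=
      (continuous_const.sub continuous_id).prodMk hflow
    simpa [P.flow_zero] using (h0.tendsto 0).mono_left (nhdsWithin_le_nhds (s := Ioi 0))
  have hcQ : Tendsto (fun u => P.Q (P.flow i u x) i j) (𝓝[>] 0) (𝓝 (P.Q x i j)) := by
    have h0 : Continuous fun u => P.Q (P.flow i u x) i j :=
      (P.continuous_Q.matrix_elem i j).comp hflow
    simpa [P.flow_zero] using (h0.tendsto 0).mono_left (nhdsWithin_le_nhds (s := Ioi 0))
  have hpos : ∀ᶠ u : ℝ in 𝓝[>] 0, 0 < u := self_mem_nhdsWithin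
  obtain ⟨u, hu, h1, h2⟩ := (hpos.and ((hc.eventually (h.eventually hO)).and
    (hcQ.eventually (lt_mem_nhds hQ)))).exists
  exact .jump hu h2 h1

theorem CanHit.of_pow_Q_pos (hO : IsOpen O) {t : ℝ} {x : EuclideanSpace ℝ (Fin d)}
    {j : Fin (m + 1)} (h : P.CanHit O t x j) (n : ℕ) :
    ∀ i, 0 < (P.Q x ^ n) i j → P.CanHit O t x i := by
  induction n with
  | zero =>
    intro i hi
    rw [pow_zero, Matrix.one_apply] at hi
    split_ifs at hi with hij
    · exact hij ▸ h
    · exact absurd hi (lt_irrefl 0)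
  | succ n ih =>
    intro i hi
    rw [pow_succ', Matrix.mul_apply] at hi
    obtain ⟨k, -, hk⟩ := Finset.exists_lt_of_sum_lt (s := Finset.univ) (f := fun _ => (0 : ℝ))
      (by simpa using hi)
    have hQk : 0 < P.Q x i k :=
      (P.Q_nonneg x i k).lt_of_ne fun h0 => by simp [← h0] at hk
    exact .of_Q_pos hO hQk (ih k (pos_of_mul_pos_right hk hQk.le))

theorem CanHit.of_mode (hO : IsOpen O) {t : ℝ} {x : EuclideanSpace ℝ (Fin d)}
    {j : Fin (m + 1)} (h : P.CanHit O t x j) (i : Fin (m + 1)) : P.CanHit O t x i := by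
  obtain ⟨n, hn⟩ := P.Q_irreducible_aperiodic x
  exact h.of_pow_Q_pos hO n i (hn i j)

theorem exists_Q_pos (P : PDMP d m) (x : EuclideanSpace ℝ (Fin d)) (i : Fin (m + 1)) :
    ∃ j, 0 < P.Q x i j := by
  obtain ⟨j, -, hj⟩ := Finset.exists_lt_of_sum_lt (s := Finset.univ) (f := fun _ => (0 : ℝ))
    (g := P.Q x i) (by simp [P.Q_sum])
  exact ⟨j, hj⟩

variable (P O)

/-- The positions from which `O` is hit, for some time and every initial mode. -/
def hitSet : Set (EuclideanSpace ℝ (Fin d)) := {x | ∃ t, ∀ i, P.CanHit O t x i}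

variable {O}

theorem isOpen_hitSet (hO : IsOpen O) : IsOpen (P.hitSet O) := by
  rw [isOpen_iff_mem_nhds]
  rintro x ⟨t, ht⟩
  have h := eventually_all.2 fun i => (ht i).eventually hO
  have hc : Tendsto (fun y : EuclideanSpace ℝ (Fin d) => (t, y)) (𝓝 x) (𝓝 (t, x)) :=
    Continuous.tendsto (by fun_prop) x
  filter_upwards [hc.eventually h] with y hy
  exact ⟨t, hy⟩

theorem subset_hitSet (hO : IsOpen O) : O ⊆ P.hitSet O := by
  intro x hx
  have hc : Tendsto (fun t => P.flow 0 t x) (𝓝[>] 0) (𝓝 x) := by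
    have h0 : Continuous fun u => P.flow 0 u x :=
      (P.continuous_flow 0).comp (by fun_prop : Continuous fun u => (u, x))
    simpa [P.flow_zero] using (h0.tendsto 0).mono_left (nhdsWithin_le_nhds (s := Ioi 0))
  have hpos : ∀ᶠ t : ℝ in 𝓝[>] 0, 0 < t := self_mem_nhdsWithin
  obtain ⟨t, ht, htx⟩ := (hpos.and (hc.eventually (hO.mem_nhds hx))).exists
  exact ⟨t, (CanHit.flow ht htx).of_mode hO⟩

theorem mem_hitSet_of_flow_mem (hO : IsOpen O) (i : Fin (m + 1)) (s : ℝ) (hs : 0 ≤ s)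
    (x : EuclideanSpace ℝ (Fin d)) (hx : P.flow i s x ∈ P.hitSet O) : x ∈ P.hitSet O := by
  rcases hs.eq_or_lt with rfl | hs
  · rwa [P.flow_zero] at hx
  · obtain ⟨t, ht⟩ := hx
    obtain ⟨j, hj⟩ := P.exists_Q_pos (P.flow i s x) i
    refine ⟨t + s, (CanHit.jump hs hj ?_).of_mode hO⟩
    rw [add_sub_cancel_right]
    exact ht j

/-- From every point of the domain of attraction of an invariant control set, the interior of that
set is hit along jump paths. -/
theorem mem_hitSet_of_mem_domainOfAttraction {V : Set (Fin (m + 1) → ℝ)}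
    (hV : V = ControlSystem.switchingRange m ∨ V = ControlSystem.convexRange m)
    {C : Set (EuclideanSpace ℝ (Fin d))}
    (hC : ControlSystem.IsInvariantControlSet P.F V C) (hC_int : (interior C).Nonempty)
    {x : EuclideanSpace ℝ (Fin d)} (hx : x ∈ ControlSystem.domainOfAttraction P.F V C) :
    x ∈ P.hitSet (interior C) := by
  obtain ⟨z, hzx, hzC⟩ := hx
  have hopen := P.isOpen_hitSet (isOpen_interior (s := C))
  have hz : z ∈ P.hitSet (interior C) := by
    obtain ⟨y, hy⟩ := hC_int
    have hyz : y ∈ closure (ControlSystem.reachable P.F V z) :=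
      hC.2 z hzC ▸ subset_closure (interior_subset hy)
    refine P.mem_of_reachable_inter_nonempty hV hopen (P.mem_hitSet_of_flow_mem isOpen_interior) ?_
    rw [inter_comm]
    exact mem_closure_iff.1 hyz _ hopen (P.subset_hitSet isOpen_interior hy)
  refine P.mem_of_reachable_inter_nonempty hV hopen (P.mem_hitSet_of_flow_mem isOpen_interior) ?_
  rw [inter_comm]
  exact mem_closure_iff.1 hzx _ hopen hz

/-- An infinite path of the embedded chain whose waiting times are positive and whose jumps have
positive probability. The waiting time at index `0` is arbitrary. -/
def IsJumpPath (ω : ℕ → Step d m) : Prop :=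
  ∀ k, 0 < (ω (k + 1)).1 ∧ (ω (k + 1)).2.1 = P.flow (ω k).2.2 (ω (k + 1)).1 (ω k).2.1 ∧
    0 < P.Q (ω (k + 1)).2.1 (ω k).2.2 (ω (k + 1)).2.2

variable {P}

theorem CanHit.exists_isJumpPath {t : ℝ} {x : EuclideanSpace ℝ (Fin d)} {i : Fin (m + 1)}
    (h : P.CanHit O t x i) (u₀ : ℝ) : ∃ ω : ℕ → Step d m, ω 0 = (u₀, x, i) ∧ P.IsJumpPath ω ∧
      ∃ n, jumpTime n ω < t ∧ t < jumpTime (n + 1) ω ∧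
        P.flow (ω n).2.2 (t - jumpTime n ω) (ω n).2.1 ∈ O := by
  induction h generalizing u₀ with
  | @flow t x i ht hx =>
    choose j hj using P.exists_Q_pos
    -- All waits of this path have length `t + 1`, so that no jump occurs up to time `t`.
    let next : Step d m → Step d m := fun s =>
      (t + 1, P.flow s.2.2 (t + 1) s.2.1, j (P.flow s.2.2 (t + 1) s.2.1) s.2.2)
    have hnext : ∀ k, next^[k + 1] (u₀, x, i) = next (next^[k] (u₀, x, i)) := fun k =>
      Function.iterate_succ_apply' _ _ _
    refine ⟨fun k => next^[k] (u₀, x, i), rfl, fun k => ?_, 0, ?_⟩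
    · simp only [hnext]
      exact ⟨by simp only [next]; linarith, rfl, hj _ _⟩
    · simp [jumpTime, next, ht, hx]
  | @jump t u x i j hu hQ _ ih =>
    obtain ⟨ω, hω0, hω, n, h1, h2, h3⟩ := ih u
    have hT : ∀ n, jumpTime (n + 1) (fun k => Nat.casesOn k (u₀, x, i) ω) = u + jumpTime n ω := by
      intro n
      simp only [jumpTime]
      rw [Finset.sum_range_succ', hω0, add_comm]
    refine ⟨fun k => Nat.casesOn k (u₀, x, i) ω, rfl, fun k => ?_, n + 1, ?_, ?_, ?_⟩
    · cases k with
      | zero => simp only [hω0]; exact ⟨hu, rfl, hQ⟩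
      | succ k => exact hω k
    · rw [hT]; linarith
    · rw [hT]; linarith
    · rw [hT, ← sub_sub]; exact h3

end PDMP

/-! ### Positivity of the law near jump paths -/

namespace PDMP

variable {d m : ℕ} (P : PDMP d m)

theorem waitingLaw_pos_of_mem_nhds {u : ℝ} (hu : 0 < u) {s : Set ℝ} (hs : s ∈ 𝓝 u) :
    0 < P.waitingLaw s := by
  have hmeas : Measurable (exponentialPDF P.rate) :=
    (measurable_exponentialPDFReal P.rate).ennreal_ofReal
  rw [pos_iff_ne_zero]
  intro h0
  have h1 : volume ({y | exponentialPDF P.rate y ≠ 0} ∩ s) = 0 :=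
    (withDensity_apply_eq_zero hmeas).1 h0
  refine (Measure.measure_pos_of_mem_nhds volume (x := u) ?_).ne' h1
  filter_upwards [Ioi_mem_nhds hu, hs] with y hy hys
  exact ⟨(ENNReal.ofReal_pos.2 (exponentialPDFReal_pos P.rate_pos hy)).ne', hys⟩

theorem waitingLaw_Iio_zero : P.waitingLaw (Iio 0) = 0 := by
  change volume.withDensity (exponentialPDF P.rate) (Iio 0) = 0
  rw [withDensity_apply _ measurableSet_Iio, lintegral_exponentialPDF_of_nonpos le_rfl]

theorem stepKernel_apply (s : Step d m) {B : Set (Step d m)} (hB : MeasurableSet B) :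
    P.stepKernel s B = ∫⁻ u, P.switchKernel (P.move (s, u)) B ∂P.waitingLaw := by
  have hmove : Measurable fun u => P.move (s, u) :=
    P.measurable_move.comp (measurable_const.prodMk measurable_id)
  have hw : P.waitKernel s = P.waitingLaw.map fun u => P.move (s, u) := by
    rw [waitKernel, Kernel.map_apply _ P.measurable_move, Kernel.prod_apply, Kernel.id_apply,
      Kernel.const_apply, Measure.dirac_prod, Measure.map_map P.measurable_move (by fun_prop)]
    rfl
  rw [stepKernel, Kernel.comp_apply' _ _ _ hB, hw,
    lintegral_map (Kernel.measurable_coe _ hB) hmove]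

theorem measurable_switchKernel_move (s : Step d m) {B : Set (Step d m)} (hB : MeasurableSet B) :
    Measurable fun u => P.switchKernel (P.move (s, u)) B :=
  (Kernel.measurable_coe _ hB).comp (P.measurable_move.comp measurable_prodMk_left)

theorem switchKernel_pos {s : Step d m} {j : Fin (m + 1)} (hQ : 0 < P.Q s.2.1 s.2.2 j)
    {B : Set (Step d m)} (hB : (s.1, s.2.1, j) ∈ B) : 0 < P.switchKernel s B := by
  change 0 < (∑ k, ENNReal.ofReal (P.Q s.2.1 s.2.2 k) • Measure.dirac (s.1, s.2.1, k)) B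
  simp only [Measure.coe_finsetSum, Finset.sum_apply, Measure.smul_apply, smul_eq_mul]
  refine lt_of_lt_of_le ?_ (Finset.single_le_sum (fun _ _ => zero_le) (Finset.mem_univ j))
  rw [Measure.dirac_apply_of_mem hB, mul_one]
  exact ENNReal.ofReal_pos.2 hQ

theorem stepKernel_neg_wait (s : Step d m) : P.stepKernel s {q | q.1 < 0} = 0 := by
  have hB : MeasurableSet {q : Step d m | q.1 < 0} := measurableSet_lt (by fun_prop) (by fun_prop)
  rw [P.stepKernel_apply s hB, lintegral_eq_zero_iff (P.measurable_switchKernel_move s hB)]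
  have hae : ∀ᵐ u ∂P.waitingLaw, 0 ≤ u := by
    rw [ae_iff]
    simp only [not_le]
    exact P.waitingLaw_Iio_zero
  filter_upwards [hae] with u hu
  change (∑ k, ENNReal.ofReal _ • Measure.dirac (u, _, k)) {q : Step d m | q.1 < 0} = 0
  simp [Measure.dirac_apply' _ hB, indicator, not_lt.2 hu]

/-- Along a jump path, the step kernel charges every neighbourhood of the next step, from every
step that is close enough to the present one. -/
theorem IsJumpPath.eventually_stepKernel_pos {ω : ℕ → Step d m} (hω : P.IsJumpPath ω) (k : ℕ)
    {B : Set (Step d m)} (hB : IsOpen B) (hBω : ω (k + 1) ∈ B) :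
    ∀ᶠ s in 𝓝 (ω k), 0 < P.stepKernel s B := by
  obtain ⟨hu, hx, hQ⟩ := hω k
  generalize ω k = r at hx hQ ⊢
  generalize ω (k + 1) = s at hBω hu hx hQ
  obtain ⟨u₀, x, i⟩ := r
  obtain ⟨u, y, j⟩ := s
  dsimp only at hu hx hQ
  subst hx
  have hstep : ∀ᶠ p : EuclideanSpace ℝ (Fin d) × ℝ in 𝓝 (x, u),
      0 < P.Q (P.flow i p.2 p.1) i j ∧ (p.2, P.flow i p.2 p.1, j) ∈ B := by
    have hf : Continuous fun p : EuclideanSpace ℝ (Fin d) × ℝ => P.flow i p.2 p.1 :=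
      (P.continuous_flow i).comp continuous_swap
    have hg : Continuous fun p : EuclideanSpace ℝ (Fin d) × ℝ =>
        ((p.2, P.flow i p.2 p.1, j) : Step d m) :=
      continuous_snd.prodMk (hf.prodMk continuous_const)
    exact (((P.continuous_Q.matrix_elem i j).comp hf).tendsto (x, u) |>.eventually
      (lt_mem_nhds hQ)).and (hg.tendsto (x, u) |>.eventually (hB.mem_nhds hBω))
  rw [nhds_prod_eq] at hstep
  have hnear : ∀ᶠ s : Step d m in 𝓝 (u₀, x, i), s.2.2 = i ∧ ∀ᶠ v in 𝓝 u,
      0 < P.Q (P.flow i v s.2.1) i j ∧ (v, P.flow i v s.2.1, j) ∈ B := by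
    have h1 : Tendsto (fun s : Step d m => s.2.2) (𝓝 (u₀, x, i)) (𝓝 i) :=
      Continuous.tendsto (by fun_prop) (u₀, x, i)
    have h2 : Tendsto (fun s : Step d m => s.2.1) (𝓝 (u₀, x, i)) (𝓝 x) :=
      Continuous.tendsto (by fun_prop) (u₀, x, i)
    exact (h1.eventually (p := fun k => k = i) (by simp [nhds_discrete])).and (h2.eventually hstep.curry)
  filter_upwards [hnear] with s hs
  obtain ⟨a, b, c⟩ := s
  obtain ⟨rfl, hs⟩ := hs
  rw [P.stepKernel_apply _ hB.measurableSet, lintegral_pos_iff_support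
    (P.measurable_switchKernel_move _ hB.measurableSet)]
  refine P.waitingLaw_pos_of_mem_nhds hu ?_
  filter_upwards [hs] with v hv
  exact (P.switchKernel_pos (s := P.move ((a, b, c), v)) hv.1 hv.2).ne'

variable (x : EuclideanSpace ℝ (Fin d)) (i : Fin (m + 1))

instance : IsProbabilityMeasure (P.law x i) := by
  unfold law
  infer_instance

/-- The Markov property of the embedded chain, for one step. -/
theorem law_frestrictLe_and_succ (n : ℕ) {A : Set ((k : Finset.Iic n) → Step d m)}
    (hA : MeasurableSet A) {B : Set (Step d m)} (hB : MeasurableSet B) :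
    P.law x i {ω | Preorder.frestrictLe n ω ∈ A ∧ ω (n + 1) ∈ B} =
      ∫⁻ ω in {ω | Preorder.frestrictLe (π := fun _ => Step d m) n ω ∈ A},
        P.stepKernel (ω n) B ∂P.law x i := by
  have hr : Measurable (Preorder.frestrictLe (π := fun _ => Step d m) n) := by fun_prop
  have h := Kernel.map_frestrictLe_trajMeasure_compProd_eq_map_trajMeasure
    (X := fun _ => Step d m) (μ₀ := Measure.dirac (0, x, i)) (a := n)
    (κ := fun n => P.stepKernel.comap
      (fun h : (k : Finset.Iic n) → Step d m => h ⟨n, Finset.mem_Iic.2 le_rfl⟩)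
      (measurable_pi_apply _))
  change ((P.law x i).map _) ⊗ₘ _ = (P.law x i).map _ at h
  have h' := congrArg (fun μ => μ (A ×ˢ B)) h
  have : IsProbabilityMeasure ((P.law x i).map
      (Preorder.frestrictLe (π := fun _ => Step d m) n)) :=
    Measure.isProbabilityMeasure_map hr.aemeasurable
  rw [Measure.compProd_apply_prod hA hB, Measure.map_apply (by fun_prop) (hA.prod hB),
    setLIntegral_map hA (Kernel.measurable_coe _ hB) hr] at h'
  exact h'.symm

theorem law_zero {B : Set (Step d m)} (hB : MeasurableSet B) (h : ((0, x, i) : Step d m) ∈ B) :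
    P.law x i {ω | ω 0 ∈ B} = 1 := by
  have hr : Measurable (Preorder.frestrictLe (π := fun _ => Step d m) 0) := by fun_prop
  have h0 : (P.law x i).map (Preorder.frestrictLe (π := fun _ => Step d m) 0) =
      (Measure.dirac ((0, x, i) : Step d m)).map
        (MeasurableEquiv.piUnique (fun _ : Finset.Iic 0 => Step d m)).symm := by
    rw [law, Kernel.trajMeasure, Measure.map_comp _ _ hr, Kernel.traj_map_frestrictLe,
      Kernel.partialTraj_self, Measure.id_comp]
  have hB' : MeasurableSet
      {w : (k : Finset.Iic 0) → Step d m | w ⟨0, Finset.mem_Iic.2 le_rfl⟩ ∈ B} :=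
    measurable_pi_apply _ hB
  have h1 := congrArg (fun μ => μ {w | w ⟨0, Finset.mem_Iic.2 le_rfl⟩ ∈ B}) h0
  rw [Measure.map_apply hr hB', Measure.map_apply (MeasurableEquiv.measurable _) hB',
    Measure.dirac_apply_of_mem (by exact h)] at h1
  exact h1

theorem ae_nonneg_wait : ∀ᵐ ω ∂P.law x i, ∀ k, 0 ≤ (ω (k + 1)).1 := by
  refine ae_all_iff.2 fun k => ?_
  have h := P.law_frestrictLe_and_succ x i k (A := univ) MeasurableSet.univ
    (B := {q | q.1 < 0}) (measurableSet_lt (by fun_prop) (by fun_prop))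
  simpa [P.stepKernel_neg_wait, ae_iff] using h

variable {P x i}

theorem IsJumpPath.law_box_pos {ω : ℕ → Step d m} (hω : P.IsJumpPath ω) (hω0 : ω 0 = (0, x, i))
    (n : ℕ) : ∀ B : ℕ → Set (Step d m), (∀ k, IsOpen (B k) ∧ ω k ∈ B k) →
      0 < P.law x i {η | ∀ k ≤ n, η k ∈ B k} := by
  induction n with
  | zero =>
    intro B hB
    simp only [Nat.le_zero, forall_eq]
    rw [P.law_zero x i (hB 0).1.measurableSet (hω0 ▸ (hB 0).2)]
    exact one_pos
  | succ n ih =>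
    intro B hB
    obtain ⟨U, hU, hUo, hωU⟩ := eventually_nhds_iff.1
      (hω.eventually_stepKernel_pos P n (hB (n + 1)).1 (hB (n + 1)).2)
    -- Shrink the last box of the past so that the kernel charges the next one from all of it.
    have hBo : ∀ k, IsOpen (Function.update B n (B n ∩ U) k) ∧
        ω k ∈ Function.update B n (B n ∩ U) k := by
      intro k
      rcases eq_or_ne k n with rfl | hk
      · simpa using ⟨(hB k).1.inter hUo, (hB k).2, hωU⟩
      · simpa [hk] using hB k
    have hB' := ih _ hBo
    let A : Set ((k : Finset.Iic n) → Step d m) :=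
      {w | ∀ k : Finset.Iic n, w k ∈ Function.update B n (B n ∩ U) k}
    have hA : MeasurableSet A := by
      rw [show A = ⋂ k : Finset.Iic n, {w | w k ∈ Function.update B n (B n ∩ U) k} by ext; simp [A]]
      exact MeasurableSet.iInter fun k => measurable_pi_apply k (hBo k).1.measurableSet
    have hAeq : {η : ℕ → Step d m | Preorder.frestrictLe (π := fun _ => Step d m) n η ∈ A} =
        {η | ∀ k ≤ n, η k ∈ Function.update B n (B n ∩ U) k} := by
      ext η
      simp [A, Preorder.frestrictLe]
    have hmark := P.law_frestrictLe_and_succ x i n hA (hB (n + 1)).1.measurableSet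
    have hmeas : Measurable fun η : ℕ → Step d m => P.stepKernel (η n) (B (n + 1)) :=
      (Kernel.measurable_coe _ (hB (n + 1)).1.measurableSet).comp (measurable_pi_apply n)
    have hpos : 0 < P.law x i
        {η | Preorder.frestrictLe n η ∈ A ∧ η (n + 1) ∈ B (n + 1)} := by
      rw [hmark, setLIntegral_pos_iff hmeas, inter_eq_right.2, hAeq]
      · exact hB'
      · intro η hη
        rw [hAeq] at hη
        have h := hη n le_rfl
        rw [Function.update_self] at h
        exact (hU _ h.2).ne'
    refine hpos.trans_le (measure_mono ?_)
    rintro η ⟨hη, hηn⟩ k hk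
    rcases hk.eq_or_lt with rfl | hk
    · exact hηn
    · have h : η k ∈ Function.update B n (B n ∩ U) k :=
        hη ⟨k, Finset.mem_Iic.2 (Nat.lt_succ_iff.1 hk)⟩
      rcases eq_or_ne k n with rfl | hkn
      · rw [Function.update_self] at h
        exact h.1
      · rwa [Function.update_of_ne hkn] at h

/-- Jump paths belong to the support of the law of the embedded chain. -/
theorem IsJumpPath.law_pos {ω : ℕ → Step d m} (hω : P.IsJumpPath ω) (hω0 : ω 0 = (0, x, i))
    {G : Set (ℕ → Step d m)} (hG : IsOpen G) (hωG : ω ∈ G) : 0 < P.law x i G := by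
  classical
  obtain ⟨I, u, hu, huG⟩ := isOpen_pi_iff.1 hG ω hωG
  refine (hω.law_box_pos hω0 (I.sup id) (fun k => if k ∈ I then u k else univ)
    fun k => ?_).trans_le (measure_mono fun η hη => huG fun k hk => ?_)
  · by_cases hk : k ∈ I
    · simpa [hk] using hu k hk
    · simp [hk]
  · have h := hη k (Finset.le_sup (f := id) hk)
    simpa [Finset.mem_coe.1 hk] using h

/-! ### The process at a fixed time -/

theorem jumpCount_eq {ω : ℕ → Step d m} (hω : ∀ k, 0 ≤ (ω (k + 1)).1) {t : ℝ} {n : ℕ}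
    (h1 : jumpTime n ω < t) (h2 : t < jumpTime (n + 1) ω) : jumpCount t ω = n := by
  have hmono : Monotone fun k => jumpTime k ω := by
    refine monotone_nat_of_le_succ fun k => ?_
    simp only [jumpTime, Finset.sum_range_succ]
    linarith [hω k]
  have hset : {k | jumpTime k ω ≤ t} = Iic n := by
    ext k
    simp only [mem_ofPred_eq, mem_Iic]
    refine ⟨fun hk => ?_, fun hk => (hmono hk).trans h1.le⟩
    by_contra! hkn
    exact absurd ((hmono (Nat.succ_le_of_lt hkn)).trans hk) (not_le.2 h2)
  rw [jumpCount, hset, csSup_Iic]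

theorem CanHit.law_process_pos {O : Set (EuclideanSpace ℝ (Fin d))} (hO : IsOpen O) {t : ℝ}
    (h : P.CanHit O t x i) : 0 < P.law x i {ω | (P.process t ω).1 ∈ O} := by
  obtain ⟨ω, hω0, hω, n, h1, h2, h3⟩ := h.exists_isJumpPath 0
  have hT : ∀ k, Continuous fun η : ℕ → Step d m => jumpTime k η := by
    intro k
    unfold jumpTime
    fun_prop
  have hflow : Continuous fun q : (ℝ × EuclideanSpace ℝ (Fin d)) × Fin (m + 1) =>
      P.flow q.2 q.1.1 q.1.2 := continuous_prod_of_discrete_right.2 P.continuous_flow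
  have hX : Continuous fun η : ℕ → Step d m =>
      P.flow (η n).2.2 (t - jumpTime n η) (η n).2.1 :=
    hflow.comp (((continuous_const.sub (hT n)).prodMk (by fun_prop)).prodMk (by fun_prop))
  have hG : IsOpen {η : ℕ → Step d m | (jumpTime n η < t ∧ t < jumpTime (n + 1) η) ∧
      P.flow (η n).2.2 (t - jumpTime n η) (η n).2.1 ∈ O} :=
    ((isOpen_lt (hT n) continuous_const).inter (isOpen_lt continuous_const (hT (n + 1)))).inter
      (hO.preimage hX)
  refine (hω.law_pos hω0 hG ⟨⟨h1, h2⟩, h3⟩).trans_le (measure_mono_ae ?_)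
  filter_upwards [P.ae_nonneg_wait x i] with η hη hηG
  change (P.process t η).1 ∈ O
  rw [process, jumpCount_eq hη hηG.1.1 hηG.1.2]
  exact hηG.2

end PDMP

theorem mainTheorem11 {d m : ℕ} (P : PDMP d m)
    (M : Set (EuclideanSpace ℝ (Fin d))) (hM : IsCompact M)
    (hM_inv : ∀ i, ∀ t : ℝ, 0 ≤ t → ∀ x ∈ M, P.flow i t x ∈ M)
    (V : Set (Fin (m + 1) → ℝ))
    (hV : V = ControlSystem.switchingRange m ∨ V = ControlSystem.convexRange m)
    (C : Set (EuclideanSpace ℝ (Fin d))) (hCM : C ⊆ M)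
    (hC : ControlSystem.IsInvariantControlSet P.F V C) (hC_int : (interior C).Nonempty)
    (x : EuclideanSpace ℝ (Fin d)) (hx : x ∈ ControlSystem.domainOfAttraction P.F V C) :
    ∃ T : ℝ, 0 < T ∧ ∃ ε : ℝ, 0 < ε ∧
      ∀ i : Fin (m + 1), ε ≤ (P.law x i).real {ω | (P.process T ω).1 ∈ interior C} := by
  obtain ⟨T, hT⟩ := P.mem_hitSet_of_mem_domainOfAttraction hV hC hC_int hx
  obtain ⟨i₀, hi₀⟩ := Finite.exists_min fun i =>
    (P.law x i).real {ω | (P.process T ω).1 ∈ interior C}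
  exact ⟨T, (hT 0).pos, _,
    ENNReal.toReal_pos ((hT i₀).law_process_pos isOpen_interior).ne' (measure_ne_top _ _), hi₀⟩
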